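/- For complex numbers $a, a_1,\dots,a_m$ and $q$ with $|q|<1$ write $(a;q)_\infty=\prod_{n=0}^{\infty}(1-aq^n)$ and $(a_1,\dots,a_m;q)_\infty=(a_1;q)_\infty\cdots(a_m;q)_\infty$. Let $h_1(n)$ be the coefficients of the power series expansion $$(-q^2,-q^3;q^5)_\infty^2\,(q^2,q^8;q^{10})_\infty=\sum_{n=0}^{\infty}h_1(n)q^n,\qquad |q|<1,$$ and put $H_r(q)=\sum_{n=0}^{\infty}h_1(5n+r)q^n$ for $0\le r\le 4$ and $|q|<1$. Then $h_1(5n+1)=0$ for all $n\ge 0$, and for all $|q|<1$ $$(-q^2,-q^3;q^5)_\infty^2\,(q^2,q^8;q^{10})_\infty=H_0(q^5)+q^2H_2(q^5)+q^3H_3(q^5)+q^4H_4(q^5),$$ where $$H_0(q)=\frac{1}{(q,q^4;q^5)_\infty^2\,(q^2,q^8;q^{10})_\infty},\qquad H_2(q)=\frac{1}{(q^2,q^3;q^5)_\infty^2\,(q^2,q^8;q^{10})_\infty},$$ $$H_3(q)=\frac{2}{(q,q^2,q^3,q^4;q^5)_\infty\,(q^4,q^6;q^{10})_\infty},\qquad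 H_4(q)=\frac{-1}{(q^2,q^3;q^5)_\infty^2\,(q^4,q^6;q^{10})_\infty}.$$ -/

import Mathlib

namespace QDissection

/-- The infinite product `(a; q)_∞ = ∏_{n ≥ 0} (1 - a q ^ n)`, for `‖q‖ < 1`. -/
noncomputable def qPoch (a q : ℂ) : ℂ := ∏' n : ℕ, (1 - a * q ^ n)

/-- The product `(a₁, …, aₘ; q)_∞ = (a₁; q)_∞ ⋯ (aₘ; q)_∞`. -/
noncomputable def qPochs (as : List ℂ) (q : ℂ) : ℂ := (as.map fun a => qPoch a q).prod

/-- For `‖q‖ < 1` the product defining `(a; q)_∞` converges, so `qPoch` is its value. -/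
theorem qPoch_multipliable (a : ℂ) {q : ℂ} (hq : ‖q‖ < 1) :
    Multipliable fun n : ℕ => 1 - a * q ^ n := by
  simp only [sub_eq_add_neg]
  apply multipliable_one_add_of_summable
  simp only [norm_neg, norm_mul, norm_pow]
  exact (summable_geometric_of_lt_one (norm_nonneg q) hq).mul_left _

/-- For `‖a‖ < 1` and `‖q‖ < 1` one has `(a; q)_∞ ≠ 0`, so reciprocals are genuine. -/
theorem qPoch_ne_zero {a q : ℂ} (ha : ‖a‖ < 1) (hq : ‖q‖ < 1) : qPoch a q ≠ 0 := by
  unfold qPoch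
  simp only [sub_eq_add_neg]
  apply tprod_one_add_ne_zero_of_summable
  · intro n hn
    have h1 : a * q ^ n = 1 := by linear_combination -hn
    have h2 : ‖a‖ * ‖q‖ ^ n = 1 := by rw [← norm_pow, ← norm_mul, h1, norm_one]
    have h3 : ‖q‖ ^ n ≤ 1 := pow_le_one₀ (norm_nonneg q) hq.le
    nlinarith [norm_nonneg a, norm_nonneg q, pow_nonneg (norm_nonneg q) n]
  · simp only [norm_neg, norm_mul, norm_pow]
    exact (summable_geometric_of_lt_one (norm_nonneg q) hq).mul_left _

/-- The function `(-q², -q³; q⁵)_∞² (q², q⁸; q¹⁰)_∞` of `q`. -/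
noncomputable def F (q : ℂ) : ℂ :=
  qPochs [-q ^ 2, -q ^ 3] (q ^ 5) ^ 2 * qPochs [q ^ 2, q ^ 8] (q ^ 10)

/-- `h₁(n)`, the coefficient of `q ^ n` in the power series expansion of `F` about `q = 0`. -/
noncomputable def h₁ (n : ℕ) : ℂ := iteratedDeriv n F 0 / (n.factorial : ℂ)

/-- The generating function `H_r(q) = ∑_{n ≥ 0} h₁(5 n + r) q ^ n`. -/
noncomputable def H (r : ℕ) (q : ℂ) : ℂ := ∑' n : ℕ, h₁ (5 * n + r) * q ^ n

end QDissection

/-!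
Put `q = p ^ 2`. The Jacobi triple product turns every infinite product in sight into a theta series
`∑ i : ℤ, ε ^ i * p ^ (a * i ^ 2 + b * i)`. A product of two theta series is a double series, which
splits over the cosets of any sublattice of `ℤ ^ 2` of finite index with an orthogonal basis
(Schröter's method). Index five splits the theta form of `F` according to exponents modulo five, but
with components in theta series of the two levels one and five. To rewrite these as products one
needs two quadratic relations between the levels. Indices two, five and six provide the product of
the first relation with its conjugate; the conjugate factor is analytic and nonzero at the origin,
hence cancels, and the second relation follows by division.
-/

namespace QDissection

open Filter Topology Finset

/-! ### The Jacobi triple product -/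

section FiniteTripleProduct

variable {K : Type*} [Field K]

/-- The reciprocal of the finite product `(1 - q) ⋯ (1 - q ^ k)`. It is extended by `0` to negative
`k`, so that `recipPoch_eq_mul_succ` holds for every integer. -/
def recipPoch (q : K) : ℤ → K
  | Int.ofNat k => (∏ i ∈ range k, (1 - q ^ (i + 1)))⁻¹
  | Int.negSucc _ => 0

lemma recipPoch_natCast (q : K) (k : ℕ) :
    recipPoch q k = (∏ i ∈ range k, (1 - q ^ (i + 1)))⁻¹ := rfl

lemma recipPoch_of_neg (q : K) {k : ℤ} (hk : k < 0) : recipPoch q k = 0 := by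
  obtain ⟨n, rfl⟩ := Int.eq_negSucc_of_lt_zero hk
  rfl

lemma recipPoch_eq_mul_succ {q : K} (hq : ∀ n : ℕ, q ^ (n + 1) ≠ 1) (k : ℤ) :
    recipPoch q k = (1 - q ^ (k + 1)) * recipPoch q (k + 1) := by
  rcases lt_trichotomy k (-1) with hk | rfl | hk
  · rw [recipPoch_of_neg q (by omega), recipPoch_of_neg q (by omega), mul_zero]
  · rw [recipPoch_of_neg q (by omega)]
    simp
  · lift k to ℕ using by omega
    have hk0 : 1 - q ^ (k + 1) ≠ 0 := sub_ne_zero.mpr (hq k).symm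
    rw [← Nat.cast_succ, zpow_natCast, recipPoch_natCast, recipPoch_natCast, prod_range_succ,
      mul_inv, mul_left_comm, mul_inv_cancel₀ hk0, mul_one]

/-- The coefficient `(q)_{2N} / ((q)_{N-n} (q)_{N+n})` of `q ^ (n² / 2) * z ^ n` in the finite form
of the triple product. -/
def centralCoeff (q : K) (N : ℕ) (n : ℤ) : K :=
  (∏ i ∈ range (2 * N), (1 - q ^ (i + 1))) * recipPoch q (N - n) * recipPoch q (N + n)

lemma centralCoeff_zero (q : K) (n : ℤ) : centralCoeff q 0 n = if n = 0 then 1 else 0 := by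
  rcases lt_trichotomy n 0 with hn | rfl | hn
  · simp [centralCoeff, recipPoch_of_neg q hn, hn.ne]
  · simp [centralCoeff, show recipPoch q 0 = 1 from inv_one]
  · simp [centralCoeff, recipPoch_of_neg q (neg_lt_zero.mpr hn), hn.ne']

lemma centralCoeff_succ {q : K} (hq0 : q ≠ 0) (hq : ∀ n : ℕ, q ^ (n + 1) ≠ 1) (N : ℕ) (n : ℤ) :
    centralCoeff q (N + 1) n = (1 + q ^ (2 * N + 1)) * centralCoeff q N n +
      q ^ (N - n + 1) * centralCoeff q N (n - 1) + q ^ (N + n + 1) * centralCoeff q N (n + 1) := by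
  have hl : recipPoch q (N - n) = (1 - q ^ (N - n) * q) * recipPoch q (N - n + 1) := by
    rw [recipPoch_eq_mul_succ hq, zpow_add_one₀ hq0]
  have hl' : recipPoch q (N - (n + 1)) = (1 - q ^ (N - n)) * recipPoch q (N - n) := by
    rw [recipPoch_eq_mul_succ hq, show (N : ℤ) - (n + 1) + 1 = N - n by ring]
  have hr : recipPoch q (N + n) = (1 - q ^ (N + n) * q) * recipPoch q (N + n + 1) := by
    rw [recipPoch_eq_mul_succ hq, zpow_add_one₀ hq0]
  have hr' : recipPoch q (N + (n - 1)) = (1 - q ^ (N + n)) * recipPoch q (N + n) := by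
    rw [recipPoch_eq_mul_succ hq, show (N : ℤ) + (n - 1) + 1 = N + n by ring]
  have hpow : q ^ (2 * N) = q ^ (N - n) * q ^ (N + n) := by
    rw [← zpow_add₀ hq0, ← zpow_natCast]
    congr 1
    push_cast
    ring
  simp only [centralCoeff]
  rw [show ((N + 1 : ℕ) : ℤ) - n = N - n + 1 by push_cast; ring,
    show ((N + 1 : ℕ) : ℤ) + n = N + n + 1 by push_cast; ring,
    show (N : ℤ) - (n - 1) = N - n + 1 by ring, show (N : ℤ) + (n + 1) = N + n + 1 by ring,
    hl', hr', hl, hr, show 2 * (N + 1) = 2 * N + 1 + 1 by ring, prod_range_succ, prod_range_succ,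
    zpow_add_one₀ hq0, zpow_add_one₀ hq0, pow_succ q (2 * N + 1), pow_succ q (2 * N), hpow]
  ring

lemma centralCoeff_succ_mul_zpow_sq {p : K} (hp0 : p ≠ 0) (hp : ∀ n : ℕ, (p ^ 2) ^ (n + 1) ≠ 1)
    (N : ℕ) (n : ℤ) :
    centralCoeff (p ^ 2) (N + 1) n * p ^ (n ^ 2) =
      (1 + p ^ (2 * N + 1) * p ^ (2 * N + 1)) * (centralCoeff (p ^ 2) N n * p ^ (n ^ 2)) +
      p ^ (2 * N + 1) * (centralCoeff (p ^ 2) N (n - 1) * p ^ ((n - 1) ^ 2)) +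
      p ^ (2 * N + 1) * (centralCoeff (p ^ 2) N (n + 1) * p ^ ((n + 1) ^ 2)) := by
  have hl : (p ^ 2) ^ (N - n + 1) * p ^ (n ^ 2) = p ^ (2 * N + 1) * p ^ ((n - 1) ^ 2) := by
    simp only [← zpow_natCast, ← zpow_mul, ← zpow_add₀ hp0]
    congr 1
    push_cast
    ring
  have hr : (p ^ 2) ^ (N + n + 1) * p ^ (n ^ 2) = p ^ (2 * N + 1) * p ^ ((n + 1) ^ 2) := by
    simp only [← zpow_natCast, ← zpow_mul, ← zpow_add₀ hp0]
    congr 1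
    push_cast
    ring
  rw [centralCoeff_succ (pow_ne_zero 2 hp0) hp]
  linear_combination centralCoeff (p ^ 2) N (n - 1) * hl + centralCoeff (p ^ 2) N (n + 1) * hr

lemma hasSum_centralCoeff [TopologicalSpace K] [IsTopologicalRing K] {p z : K} (hp0 : p ≠ 0)
    (hp : ∀ n : ℕ, (p ^ 2) ^ (n + 1) ≠ 1) (hz : z ≠ 0) (N : ℕ) :
    HasSum (fun n : ℤ => centralCoeff (p ^ 2) N n * p ^ (n ^ 2) * z ^ n)
      (∏ k ∈ range N, ((1 + z * p ^ (2 * k + 1)) * (1 + z⁻¹ * p ^ (2 * k + 1)))) := by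
  induction N with
  | zero =>
    convert! hasSum_ite_eq (0 : ℤ) (1 : K) using 2 with n
    by_cases hn : n = 0 <;> simp [centralCoeff_zero, hn]
  | succ N ih =>
    have hprev := (Equiv.subRight (1 : ℤ)).hasSum_iff.mpr ih
    have hnext := (Equiv.addRight (1 : ℤ)).hasSum_iff.mpr ih
    have h := ((ih.mul_left (1 + p ^ (2 * N + 1) * p ^ (2 * N + 1))).add
      (hprev.mul_left (z * p ^ (2 * N + 1)))).add (hnext.mul_left (z⁻¹ * p ^ (2 * N + 1)))
    convert! h using 1
    · funext n
      simp only [Function.comp, Equiv.subRight_apply, Equiv.coe_addRight]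
      rw [centralCoeff_succ_mul_zpow_sq hp0 hp, zpow_sub_one₀ hz, zpow_add_one₀ hz]
      field_simp
    · rw [prod_range_succ]
      field_simp
      ring

end FiniteTripleProduct

lemma norm_pow_lt_one {q : ℂ} (hq : ‖q‖ < 1) {k : ℕ} (hk : k ≠ 0) : ‖q ^ k‖ < 1 := by
  rw [norm_pow]
  exact pow_lt_one₀ (norm_nonneg q) hq hk

lemma pow_succ_ne_one {q : ℂ} (hq : ‖q‖ < 1) (n : ℕ) : q ^ (n + 1) ≠ 1 := fun h => by
  simpa [h] using norm_pow_lt_one hq n.succ_ne_zero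

lemma tendsto_prod_range_qPoch (a : ℂ) {q : ℂ} (hq : ‖q‖ < 1) :
    Tendsto (fun N => ∏ i ∈ range N, (1 - a * q ^ i)) atTop (𝓝 (qPoch a q)) :=
  (qPoch_multipliable a hq).hasProd.tendsto_prod_nat

lemma tendsto_prod_range_one_sub_pow {q : ℂ} (hq : ‖q‖ < 1) :
    Tendsto (fun N => ∏ i ∈ range N, (1 - q ^ (i + 1))) atTop (𝓝 (qPoch q q)) := by
  simpa only [pow_succ'] using tendsto_prod_range_qPoch q hq

lemma tendsto_recipPoch {q : ℂ} (hq : ‖q‖ < 1) :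
    Tendsto (recipPoch q) atTop (𝓝 (qPoch q q)⁻¹) := by
  rw [← Nat.map_cast_int_atTop, tendsto_map'_iff]
  exact (tendsto_prod_range_one_sub_pow hq).inv₀ (qPoch_ne_zero hq hq)

lemma tendsto_centralCoeff {q : ℂ} (hq : ‖q‖ < 1) (n : ℤ) :
    Tendsto (fun N => centralCoeff q N n) atTop (𝓝 (qPoch q q)⁻¹) := by
  have hnum := (tendsto_prod_range_one_sub_pow hq).comp
    (tendsto_id.const_mul_atTop' (two_pos : (0 : ℕ) < 2))
  have hminus := (tendsto_recipPoch hq).comp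
    (tendsto_atTop_add_const_right atTop (-n) (tendsto_natCast_atTop_atTop (R := ℤ)))
  have hplus := (tendsto_recipPoch hq).comp
    (tendsto_atTop_add_const_right atTop n (tendsto_natCast_atTop_atTop (R := ℤ)))
  have h := (hnum.mul hminus).mul hplus
  rwa [mul_inv_cancel₀ (qPoch_ne_zero hq hq), one_mul] at h

lemma exists_norm_centralCoeff_le {q : ℂ} (hq : ‖q‖ < 1) :
    ∃ C : ℝ, ∀ N n, ‖centralCoeff q N n‖ ≤ C := by
  have hlim := tendsto_prod_range_one_sub_pow hq
  obtain ⟨C, hC⟩ := hlim.norm.bddAbove_range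
  obtain ⟨C', hC'⟩ := (hlim.inv₀ (qPoch_ne_zero hq hq)).norm.bddAbove_range
  replace hC (N : ℕ) : ‖∏ i ∈ range N, (1 - q ^ (i + 1))‖ ≤ C := hC ⟨N, rfl⟩
  replace hC' (N : ℕ) : ‖recipPoch q N‖ ≤ C' := hC' ⟨N, rfl⟩
  have hrecip (k : ℤ) : ‖recipPoch q k‖ ≤ C' := by
    cases k with
    | ofNat k => exact hC' k
    | negSucc k => simpa [recipPoch] using (norm_nonneg _).trans (hC' 0)
  have hC0 : 0 ≤ C := (norm_nonneg _).trans (hC 0)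
  have hC'0 : 0 ≤ C' := (norm_nonneg _).trans (hC' 0)
  refine ⟨C * C' * C', fun N n => ?_⟩
  rw [centralCoeff, norm_mul, norm_mul]
  gcongr
  exacts [hC _, hrecip _, hrecip _]

/-! ### Theta series -/

/-- The theta series `∑ ε ^ n * q ^ (A n² + B n)` over all integers `n`. In Ramanujan's notation it
is `f(ε q ^ (A + B), ε⁻¹ q ^ (A - B))`; integer parameters make it a function of `q` alone, and
`f(-q, -q⁴)`, say, is reached as `theta (-1) 5 3` at a square root of `q`. -/
noncomputable def theta (ε : ℂ) (A B : ℤ) (q : ℂ) : ℂ := ∑' n : ℤ, ε ^ n * q ^ (A * n ^ 2 + B * n)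

lemma summable_zpow_mul_zpow_quadratic {A : ℤ} (hA : 0 < A) (B : ℤ) {ρ r : ℝ} (hρ : 0 < ρ)
    (hr0 : 0 < r) (hr : r < 1) : Summable fun n : ℤ => ρ ^ n * r ^ (A * n ^ 2 + B * n) := by
  -- The terms are the norms of the terms of a Jacobi theta function in Mathlib's normalisation.
  let τ : ℂ := ⟨0, -(A * Real.log r) / Real.pi⟩
  let z : ℂ := ⟨0, -(Real.log ρ + B * Real.log r) / (2 * Real.pi)⟩
  have hτ : 0 < τ.im :=
    div_pos (neg_pos.mpr (mul_neg_of_pos_of_neg (by exact_mod_cast hA) (Real.log_neg hr0 hr)))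
      Real.pi_pos
  refine ((summable_jacobiTheta₂_term_iff z τ).mpr hτ).norm.congr fun n => ?_
  rw [norm_jacobiTheta₂_term, ← Real.rpow_intCast, ← Real.rpow_intCast, Real.rpow_def_of_pos hρ,
    Real.rpow_def_of_pos hr0, ← Real.exp_add]
  congr 1
  simp only [τ, z]
  push_cast
  field_simp
  ring

lemma summable_norm_theta {ε : ℂ} (hε : ε ≠ 0) {A : ℤ} (hA : 0 < A) (B : ℤ) {q : ℂ} (hq0 : q ≠ 0)
    (hq : ‖q‖ < 1) : Summable fun n : ℤ => ‖ε ^ n * q ^ (A * n ^ 2 + B * n)‖ := by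
  simpa only [norm_mul, norm_zpow] using
    summable_zpow_mul_zpow_quadratic hA B (norm_pos_iff.mpr hε) (norm_pos_iff.mpr hq0) hq

theorem jacobi_triple_product {z p : ℂ} (hz : z ≠ 0) (hp0 : p ≠ 0) (hp : ‖p‖ < 1) :
    theta z 1 0 p =
      qPoch (p ^ 2) (p ^ 2) * (qPoch (-(z * p)) (p ^ 2) * qPoch (-(z⁻¹ * p)) (p ^ 2)) := by
  have hq : ‖p ^ 2‖ < 1 := norm_pow_lt_one hp two_ne_zero
  obtain ⟨C, hC⟩ := exists_norm_centralCoeff_le hq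
  have hsum : Tendsto (fun N : ℕ => ∑' n : ℤ, centralCoeff (p ^ 2) N n * p ^ (n ^ 2) * z ^ n) atTop
      (𝓝 (∑' n : ℤ, (qPoch (p ^ 2) (p ^ 2))⁻¹ * p ^ (n ^ 2) * z ^ n)) := by
    refine tendsto_tsum_of_dominated_convergence
      ((summable_norm_theta hz one_pos 0 hp0 hp).mul_left C)
      (fun n => ((tendsto_centralCoeff hq n).mul_const _).mul_const _)
      (Eventually.of_forall fun N n => ?_)
    rw [mul_assoc, norm_mul, one_mul, zero_mul, add_zero, mul_comm (z ^ n)]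
    exact mul_le_mul_of_nonneg_right (hC N n) (norm_nonneg _)
  have hprod : Tendsto (fun N : ℕ => ∑' n : ℤ, centralCoeff (p ^ 2) N n * p ^ (n ^ 2) * z ^ n) atTop
      (𝓝 (qPoch (-(z * p)) (p ^ 2) * qPoch (-(z⁻¹ * p)) (p ^ 2))) := by
    refine ((tendsto_prod_range_qPoch _ hq).mul (tendsto_prod_range_qPoch _ hq)).congr fun N => ?_
    rw [(hasSum_centralCoeff hp0 (pow_succ_ne_one hq) hz N).tsum_eq, ← prod_mul_distrib]
    refine prod_congr rfl fun k _ => ?_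
    ring
  rw [← tendsto_nhds_unique hsum hprod]
  simp only [mul_assoc]
  rw [tsum_mul_left, mul_inv_cancel_left₀ (qPoch_ne_zero hq hq)]
  simp [theta, mul_comm]

theorem theta_eq_mul_qPoch {ε : ℂ} (hε : ε ≠ 0) {A : ℤ} (hA : 0 < A) (B : ℤ) {p : ℂ} (hp0 : p ≠ 0)
    (hp : ‖p‖ < 1) :
    theta ε A B p = qPoch (p ^ (2 * A)) (p ^ (2 * A)) *
      (qPoch (-(ε * p ^ (A + B))) (p ^ (2 * A)) * qPoch (-(ε⁻¹ * p ^ (A - B))) (p ^ (2 * A))) := by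
  have hbase : theta ε A B p = theta (ε * p ^ B) 1 0 (p ^ A) := by
    refine tsum_congr fun n => ?_
    rw [mul_zpow, ← zpow_mul, ← zpow_mul, zpow_add₀ hp0]
    ring_nf
  have hpA : ‖p ^ A‖ < 1 := by
    rw [norm_zpow]
    exact zpow_lt_one₀ (norm_pos_iff.mpr hp0) hp hA
  have hsq : (p ^ A) ^ 2 = p ^ (2 * A) := by rw [← zpow_ofNat, ← zpow_mul, mul_comm]
  rw [hbase, jacobi_triple_product (mul_ne_zero hε (zpow_ne_zero _ hp0))
    (zpow_ne_zero _ hp0) hpA, hsq, zpow_add₀ hp0, zpow_sub₀ hp0, mul_inv]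
  congr 4
  · ring
  · ring

lemma theta_neg_right (ε : ℂ) (A B : ℤ) (q : ℂ) : theta ε A (-B) q = theta ε⁻¹ A B q := by
  rw [theta, ← (Equiv.neg ℤ).tsum_eq]
  refine tsum_congr fun n => ?_
  rw [Equiv.neg_apply, zpow_neg, inv_zpow, neg_sq, neg_mul_neg]

/-- The terms of index `n` and `-1 - n` cancel. -/
lemma theta_neg_one_self (A : ℤ) (q : ℂ) : theta (-1) A A q = 0 := by
  have h : theta (-1) A A q = -theta (-1) A A q := by
    conv_lhs => rw [theta, ← (Equiv.subLeft (-1 : ℤ)).tsum_eq]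
    rw [theta, ← tsum_neg]
    refine tsum_congr fun n => ?_
    have hsign : (-1 : ℂ) ^ (-1 - n) = -(-1) ^ n := by
      rw [zpow_sub₀ (by norm_num), zpow_neg_one, inv_neg_one, div_eq_mul_inv, ← inv_zpow,
        inv_neg_one, neg_one_mul]
    rw [Equiv.subLeft_apply, hsign, neg_mul]
    ring_nf
  exact self_eq_neg.mp h

lemma theta_pow (ε : ℂ) (A B : ℤ) (q : ℂ) (k : ℕ) :
    theta ε A B (q ^ k) = theta ε (k * A) (k * B) q := by
  refine tsum_congr fun n => ?_
  rw [← zpow_natCast, ← zpow_mul]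
  ring_nf

lemma theta_ne_zero {ε : ℂ} (hε : ‖ε‖ = 1) {A B : ℤ} (hB : |B| < A) {q : ℂ} (hq0 : q ≠ 0)
    (hq : ‖q‖ < 1) : theta ε A B q ≠ 0 := by
  have hε0 : ε ≠ 0 := norm_ne_zero_iff.mp (by simp [hε])
  have hlt {k : ℤ} (hk : 0 < k) : ‖q ^ k‖ < 1 := by
    rw [norm_zpow]
    exact zpow_lt_one₀ (norm_pos_iff.mpr hq0) hq hk
  obtain ⟨hAB, hAB'⟩ := abs_lt.mp hB
  have hA : ‖q ^ (2 * A)‖ < 1 := hlt (by omega)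
  rw [theta_eq_mul_qPoch hε0 (by omega) B hq0 hq]
  refine mul_ne_zero (qPoch_ne_zero hA hA) (mul_ne_zero (qPoch_ne_zero ?_ hA) (qPoch_ne_zero ?_ hA))
  · simpa [hε] using hlt (k := A + B) (by omega)
  · simpa [hε] using hlt (k := A - B) (by omega)

lemma theta_eq_sum_theta {ε : ℂ} (hε : ε ≠ 0) {A : ℤ} (hA : 0 < A) (B : ℤ) {q : ℂ} (hq0 : q ≠ 0)
    (hq : ‖q‖ < 1) (k : ℕ) [NeZero k] :
    theta ε A B q = ∑ r : Fin k, ε ^ (r : ℤ) * q ^ (A * r ^ 2 + B * r : ℤ) *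
      theta (ε ^ k) (k ^ 2 * A) (k * (2 * A * r + B)) q := by
  let e : Fin k × ℤ ≃ ℤ := (Equiv.prodComm _ _).trans (Int.divModEquiv k).symm
  have hs := e.summable_iff.mpr (summable_norm_theta hε hA B hq0 hq).of_norm
  rw [theta, ← e.tsum_eq]
  refine (hs.tsum_prod.trans (tsum_fintype _)).trans (sum_congr rfl fun r _ => ?_)
  rw [theta, ← tsum_mul_left]
  refine tsum_congr fun u => ?_
  have he : e (r, u) = r + k * u := by simp [e, add_comm, mul_comm]
  rw [Function.comp_apply, he, mul_mul_mul_comm, ← zpow_natCast, ← zpow_mul, ← zpow_add₀ hε,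
    ← zpow_add₀ hq0]
  ring_nf

lemma quadratic_nonneg {A B : ℤ} (hB : |B| ≤ A) (n : ℤ) : 0 ≤ A * n ^ 2 + B * n := by
  have hn : |n| ≤ n ^ 2 := by
    simpa using Int.natAbs_le_self_sq n
  have : |B * n| ≤ A * n ^ 2 := by
    rw [abs_mul]
    exact mul_le_mul hB hn (abs_nonneg n) ((abs_nonneg B).trans hB)
  linarith [neg_abs_le (B * n)]

lemma differentiableOn_theta {ε : ℂ} (hε : ε ≠ 0) {A B : ℤ} (hA : 0 < A) (hB : |B| ≤ A) :
    DifferentiableOn ℂ (theta ε A B) (Metric.ball 0 1) := by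
  intro w hw
  obtain ⟨r, hwr, hr⟩ := exists_between (mem_ball_zero_iff.mp hw)
  have hr0 : 0 < r := (norm_nonneg w).trans_lt hwr
  have h : DifferentiableOn ℂ (theta ε A B) (Metric.ball 0 r) := by
    refine Complex.differentiableOn_tsum_of_summable_norm
      (summable_zpow_mul_zpow_quadratic hA B (norm_pos_iff.mpr hε) hr0 hr) (fun n z _ => ?_)
      Metric.isOpen_ball (fun n z hz => ?_)
    · exact ((differentiableAt_zpow.mpr (Or.inr (quadratic_nonneg hB n))).const_mul
        _).differentiableWithinAt
    · rw [norm_mul, norm_zpow, norm_zpow]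
      gcongr
      exact zpow_le_zpow_left₀ (quadratic_nonneg hB n) (norm_nonneg z) (mem_ball_zero_iff.mp hz).le
  exact (h.differentiableAt (Metric.isOpen_ball.mem_nhds
    (mem_ball_zero_iff.mpr hwr))).differentiableWithinAt

lemma theta_zero_right (ε : ℂ) {A B : ℤ} (hB : |B| < A) : theta ε A B 0 = 1 := by
  rw [theta, tsum_eq_single 0]
  · simp
  · intro n hn
    have hexp : A * n ^ 2 + B * n ≠ 0 := by
      rw [show A * n ^ 2 + B * n = (A * n + B) * n by ring]
      refine mul_ne_zero (fun h => ?_) hn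
      have : A ∣ B := (dvd_add_right (dvd_mul_right A n)).mp (h ▸ dvd_zero A)
      have hB0 := Int.eq_zero_of_abs_lt_dvd this hB
      simp_all
    rw [zero_zpow _ hexp, mul_zero]

lemma qPoch_eq_prod_qPoch_pow (a : ℂ) {q : ℂ} (hq : ‖q‖ < 1) (k : ℕ) [NeZero k] :
    qPoch a q = ∏ j : Fin k, qPoch (a * q ^ (j : ℕ)) (q ^ k) := by
  have hqk : ‖q ^ k‖ < 1 := norm_pow_lt_one hq (NeZero.ne k)
  let e : Fin k × ℕ ≃ ℕ := (Equiv.prodComm _ _).trans (Nat.divModEquiv k).symm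
  have h := e.hasProd_iff.mpr (qPoch_multipliable a hq).hasProd
  have hfiber (j : Fin k) : HasProd (fun n : ℕ => 1 - a * q ^ e (j, n))
      (qPoch (a * q ^ (j : ℕ)) (q ^ k)) := by
    convert! (qPoch_multipliable (a * q ^ (j : ℕ)) hqk).hasProd using 2 with n
    simp only [e, Equiv.trans_apply, Equiv.prodComm_apply, Prod.swap_prod_mk,
      Nat.divModEquiv_symm_apply]
    ring
  exact (h.prod_fiberwise hfiber).unique (hasProd_fintype _)

/-! ### Products of two theta series -/

lemma bijective_lattice_cosets {N : ℕ} [NeZero N] {a b c d μ : ℤ} (hdet : a * d - b * c = N)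
    (hac : (N : ℤ) ∣ a + μ * c) (hbd : (N : ℤ) ∣ b + μ * d) {m n : Fin N → ℤ}
    (hmn : ∀ k, m k + μ * n k ≡ k [ZMOD N]) :
    Function.Bijective fun x : Fin N × ℤ × ℤ =>
      (a * x.2.1 + b * x.2.2 + m x.1, c * x.2.1 + d * x.2.2 + n x.1) := by
  have hN : (N : ℤ) ≠ 0 := Nat.cast_ne_zero.mpr (NeZero.ne N)
  constructor
  · rintro ⟨k, u, v⟩ ⟨k', u', v'⟩ h
    obtain ⟨hx, hy⟩ := Prod.mk.inj h
    dsimp only at hx hy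
    have hk : (k : ℤ) ≡ k' [ZMOD N] := by
      refine (hmn k).symm.trans (Int.ModEq.trans (Int.modEq_iff_dvd.mpr ?_) (hmn k'))
      have := dvd_add (hac.mul_right (u - u')) (hbd.mul_right (v - v'))
      convert! this using 1
      linear_combination -hx - μ * hy
    obtain rfl : k = k' := Fin.ext (by
      have := Int.natCast_modEq_iff.mp hk
      rwa [Nat.ModEq, Nat.mod_eq_of_lt k.is_lt, Nat.mod_eq_of_lt k'.is_lt] at this)
    refine Prod.ext rfl (Prod.ext (mul_left_cancel₀ hN ?_) (mul_left_cancel₀ hN ?_))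
    · linear_combination -(u - u') * hdet + d * hx - b * hy
    · linear_combination -(v - v') * hdet - c * hx + a * hy
  · rintro ⟨x, y⟩
    obtain ⟨k, hk⟩ : ∃ k : Fin N, x + μ * y ≡ k [ZMOD N] := by
      refine ⟨Fin.ofNat N ((x + μ * y).natMod N), ?_⟩
      rw [Fin.val_ofNat, Int.natCast_mod, Int.natMod, Int.toNat_of_nonneg (Int.emod_nonneg _ hN)]
      simp [Int.ModEq]
    obtain ⟨s, hs⟩ := hac
    obtain ⟨t, ht⟩ := hbd
    obtain ⟨w, hw⟩ := (hk.trans (hmn k).symm).symm.dvd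
    refine ⟨(k, d * w - t * (y - n k), s * (y - n k) - c * w),
      Prod.ext (mul_left_cancel₀ hN ?_) (mul_left_cancel₀ hN ?_)⟩
    · linear_combination (N * w - μ * (y - n k)) * hdet - N * hw + a * (y - n k) * ht -
        b * (y - n k) * hs
    · linear_combination (y - n k) * hdet + c * (y - n k) * ht - d * (y - n k) * hs

/-- Schröter's method. The hypotheses say that `(a, c)` and `(b, d)` span the kernel of
`(x, y) ↦ x + μ y` modulo `N` and are orthogonal for the form `A x² + A' y²`, and that the points
`(m k, n k)` represent the cosets of that kernel. -/
theorem theta_mul_theta_eq_sum {N : ℕ} [NeZero N] {a b c d μ : ℤ} (hdet : a * d - b * c = N)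
    (hac : (N : ℤ) ∣ a + μ * c) (hbd : (N : ℤ) ∣ b + μ * d) {m n : Fin N → ℤ}
    (hmn : ∀ k, m k + μ * n k ≡ k [ZMOD N]) {ε ε' : ℂ} (hε : ε ≠ 0) (hε' : ε' ≠ 0) {A A' : ℤ}
    (hA : 0 < A) (hA' : 0 < A') (horth : A * a * b + A' * c * d = 0) (B B' : ℤ) {q : ℂ}
    (hq0 : q ≠ 0) (hq : ‖q‖ < 1) :
    theta ε A B q * theta ε' A' B' q =
      ∑ k, ε ^ m k * ε' ^ n k * q ^ (A * m k ^ 2 + B * m k + (A' * n k ^ 2 + B' * n k)) *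
        (theta (ε ^ a * ε' ^ c) (A * a ^ 2 + A' * c ^ 2)
            (a * (2 * A * m k + B) + c * (2 * A' * n k + B')) q *
          theta (ε ^ b * ε' ^ d) (A * b ^ 2 + A' * d ^ 2)
            (b * (2 * A * m k + B) + d * (2 * A' * n k + B')) q) := by
  have hN : (N : ℤ) ≠ 0 := Nat.cast_ne_zero.mpr (NeZero.ne N)
  have hpos {x y : ℤ} (h : x ≠ 0 ∨ y ≠ 0) : 0 < A * x ^ 2 + A' * y ^ 2 := by
    rcases h with h | h <;> positivity
  have hL : 0 < A * a ^ 2 + A' * c ^ 2 := hpos (by by_contra! h; simp [h.1, h.2] at hdet; omega)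
  have hL' : 0 < A * b ^ 2 + A' * d ^ 2 := hpos (by by_contra! h; simp [h.1, h.2] at hdet; omega)
  have hη : ε ^ a * ε' ^ c ≠ 0 := mul_ne_zero (zpow_ne_zero _ hε) (zpow_ne_zero _ hε')
  have hη' : ε ^ b * ε' ^ d ≠ 0 := mul_ne_zero (zpow_ne_zero _ hε) (zpow_ne_zero _ hε')
  let e := Equiv.ofBijective _ (bijective_lattice_cosets hdet hac hbd hmn)
  have hf := summable_norm_theta hε hA B hq0 hq
  have hf' := summable_norm_theta hε' hA' B' hq0 hq
  have hs := e.summable_iff.mpr (summable_mul_of_summable_norm hf hf')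
  rw [theta, theta, tsum_mul_tsum_of_summable_norm hf hf', ← e.tsum_eq]
  refine (hs.tsum_prod.trans (tsum_fintype _)).trans (sum_congr rfl fun k _ => ?_)
  rw [theta, theta, tsum_mul_tsum_of_summable_norm (summable_norm_theta hη hL _ hq0 hq)
    (summable_norm_theta hη' hL' _ hq0 hq), ← tsum_mul_left]
  refine tsum_congr fun ⟨u, v⟩ => ?_
  simp only [e, Function.comp_apply, Equiv.ofBijective_apply, mul_zpow, ← zpow_mul]
  have hexp : q ^ (A * (a * u + b * v + m k) ^ 2 + B * (a * u + b * v + m k)) *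
      q ^ (A' * (c * u + d * v + n k) ^ 2 + B' * (c * u + d * v + n k)) =
      q ^ (A * m k ^ 2 + B * m k + (A' * n k ^ 2 + B' * n k)) *
        (q ^ ((A * a ^ 2 + A' * c ^ 2) * u ^ 2 +
            (a * (2 * A * m k + B) + c * (2 * A' * n k + B')) * u) *
          q ^ ((A * b ^ 2 + A' * d ^ 2) * v ^ 2 +
            (b * (2 * A * m k + B) + d * (2 * A' * n k + B')) * v)) := by
    simp only [← zpow_add₀ hq0]
    congr 1
    linear_combination 2 * u * v * horth
  rw [mul_mul_mul_comm, hexp]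
  simp only [zpow_add₀ hε, zpow_add₀ hε']
  ring

section LevelFive

variable {p q : ℂ}

lemma theta_mul_theta_same_level {ε : ℂ} (hε : ε ≠ 0) {A : ℤ} (hA : 0 < A) (C D : ℤ) (hp0 : p ≠ 0)
    (hp : ‖p‖ < 1) :
    theta ε A (C + D) p * theta ε A (C - D) p =
      theta (ε ^ 2) A C (p ^ 2) * theta 1 A D (p ^ 2) +
        ε⁻¹ * p ^ (A - C - D) *
          (theta (ε ^ 2) A (C - A) (p ^ 2) * theta 1 A (D - A) (p ^ 2)) := by
  have h := theta_mul_theta_eq_sum (N := 2) (a := 1) (b := 1) (c := -1) (d := 1)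
    (μ := 1) (m := ![0, -1]) (n := ![0, 0]) (by norm_num) (by norm_num) (by norm_num) (by decide)
    hε hε hA hA (by ring) (C + D) (C - D) hp0 hp
  simp only [Fin.sum_univ_two, Matrix.cons_val] at h
  rw [h, zpow_neg_one, zpow_one, mul_inv_cancel₀ hε]
  simp only [theta_pow, Nat.cast_ofNat, zpow_zero]
  ring_nf
  rw [zpow_zero, one_mul]

lemma theta_one_one_zero_sq (hq0 : q ≠ 0) (hq : ‖q‖ < 1) :
    theta 1 1 0 q ^ 2 = theta 1 5 0 q ^ 2 + 4 * q * (theta 1 5 4 q * theta 1 5 2 q) := by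
  have h := theta_mul_theta_eq_sum (N := 5) (a := 2) (b := 1) (c := -1) (d := 2) (μ := 2)
    (m := ![0, 1, 0, 0, -1]) (n := ![0, 0, 1, -1, 0]) (by norm_num) (by norm_num) (by norm_num)
    (by decide) one_ne_zero one_ne_zero (A := 1) (A' := 1) one_pos one_pos (by norm_num) 0 0 hq0 hq
  simp only [Fin.sum_univ_five, Matrix.cons_val] at h
  norm_num [theta_neg_right] at h
  linear_combination h

lemma theta_one_one_one_sq (hq0 : q ≠ 0) (hq : ‖q‖ < 1) :
    theta 1 1 1 q ^ 2 = q ^ 2 * theta 1 5 5 q ^ 2 + 4 * (theta 1 5 3 q * theta 1 5 1 q) := by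
  have h := theta_mul_theta_eq_sum (N := 5) (a := 2) (b := 1) (c := -1) (d := 2) (μ := 2)
    (m := ![0, 1, -1, 0, -1]) (n := ![0, 0, -1, -1, 0]) (by norm_num) (by norm_num) (by norm_num)
    (by decide) one_ne_zero one_ne_zero (A := 1) (A' := 1) one_pos one_pos (by norm_num) 1 1 hq0 hq
  simp only [Fin.sum_univ_five, Matrix.cons_val] at h
  norm_num [theta_neg_right, zpow_ofNat] at h
  linear_combination h

lemma theta_five_one_mul_theta_neg_five_three (hq0 : q ≠ 0) (hq : ‖q‖ < 1) :
    theta 1 5 1 q * theta (-1) 5 3 q =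
      theta (-1) 5 1 (q ^ 5) * theta 1 5 1 (q ^ 5) -
        q ^ 2 * (theta (-1) 5 1 (q ^ 5) * theta 1 5 3 (q ^ 5)) -
        q ^ 8 * (theta (-1) 5 3 (q ^ 5) * theta 1 5 5 (q ^ 5)) +
        q ^ 4 * (theta (-1) 5 3 (q ^ 5) * theta 1 5 3 (q ^ 5)) := by
  have h := theta_mul_theta_eq_sum (N := 5) (a := 2) (b := -1) (c := 1) (d := 2) (μ := 3)
    (m := ![0, 1, 0, 0, -1]) (n := ![0, 0, -1, 1, 0]) (by norm_num) (by norm_num) (by norm_num)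
    (by decide) one_ne_zero (neg_ne_zero.mpr one_ne_zero) (A := 5) (A' := 5) (by norm_num)
    (by norm_num) (by norm_num) 1 3 hq0 hq
  simp only [Fin.sum_univ_five, Matrix.cons_val] at h
  norm_num [theta_neg_right, theta_pow, theta_neg_one_self, zpow_ofNat] at h ⊢
  linear_combination h

lemma theta_five_four_mul_theta_neg_five_three (hq0 : q ≠ 0) (hq : ‖q‖ < 1) :
    theta 1 5 4 q * theta (-1) 5 3 q =
      theta (-1) 5 1 (q ^ 5) * theta 1 5 2 (q ^ 5) +
        q * (theta (-1) 5 3 (q ^ 5) * theta 1 5 0 (q ^ 5)) -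
        q ^ 2 * (theta (-1) 5 3 (q ^ 5) * theta 1 5 2 (q ^ 5)) -
        q ^ 3 * (theta (-1) 5 1 (q ^ 5) * theta 1 5 4 (q ^ 5)) := by
  have h := theta_mul_theta_eq_sum (N := 5) (a := 2) (b := 1) (c := -1) (d := 2) (μ := 2)
    (m := ![0, 1, -1, 0, -1]) (n := ![0, 0, -1, -1, 0]) (by norm_num) (by norm_num) (by norm_num)
    (by decide) one_ne_zero (neg_ne_zero.mpr one_ne_zero) (A := 5) (A' := 5) (by norm_num)
    (by norm_num) (by norm_num) 4 3 hq0 hq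
  simp only [Fin.sum_univ_five, Matrix.cons_val] at h
  norm_num [theta_neg_right, theta_pow, theta_neg_one_self, zpow_ofNat] at h ⊢
  linear_combination h

lemma theta_five_one_sq {ε : ℂ} (hε : ε ^ 2 = 1) (hp0 : p ≠ 0) (hp : ‖p‖ < 1) :
    theta ε 5 1 p ^ 2 = theta 1 5 1 (p ^ 2) * theta 1 5 0 (p ^ 2) +
      ε * p ^ 4 * (theta 1 5 4 (p ^ 2) * theta 1 5 5 (p ^ 2)) := by
  have hε0 : ε ≠ 0 := right_ne_zero_of_mul (a := ε) (by simp [← sq, hε])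
  have h := theta_mul_theta_same_level hε0 (A := 5) (by norm_num) 1 0 hp0 hp
  norm_num [theta_neg_right, hε, zpow_ofNat, inv_eq_of_mul_eq_one_right (sq ε ▸ hε)] at h
  rw [sq, h]

lemma theta_neg_five_three_sq (hp0 : p ≠ 0) (hp : ‖p‖ < 1) :
    theta (-1) 5 3 p ^ 2 = theta 1 5 3 (p ^ 2) * theta 1 5 0 (p ^ 2) -
      p ^ 2 * (theta 1 5 2 (p ^ 2) * theta 1 5 5 (p ^ 2)) := by
  have h := theta_mul_theta_same_level (ε := -1) (by norm_num) (A := 5) (by norm_num) 3 0 hp0 hp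
  norm_num [theta_neg_right, zpow_ofNat] at h
  linear_combination h

lemma theta_neg_five_three_mul_theta_neg_five_one (hp0 : p ≠ 0) (hp : ‖p‖ < 1) :
    theta (-1) 5 3 p * theta (-1) 5 1 p = theta 1 5 2 (p ^ 2) * theta 1 5 1 (p ^ 2) -
      p ^ 2 * (theta 1 5 3 (p ^ 2) * theta 1 5 4 (p ^ 2)) := by
  have h := theta_mul_theta_same_level (ε := -1) (by norm_num) (A := 5) (by norm_num) 2 1 hp0 hp
  norm_num [theta_neg_right, zpow_ofNat] at h
  linear_combination h

lemma theta_neg_three_one_eq_sub (hq0 : q ≠ 0) (hq : ‖q‖ < 1) :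
    theta (-1) 3 1 q = theta 1 12 2 q - q ^ 2 * theta 1 12 10 q := by
  have h := theta_eq_sum_theta (ε := -1) (by norm_num) (A := 3) (by norm_num) (-1) hq0 hq 2
  norm_num [Fin.sum_univ_two, theta_neg_right, zpow_ofNat] at h
  linear_combination h

lemma theta_two_two_mul_theta_ten_zero (hp0 : p ≠ 0) (hp : ‖p‖ < 1) :
    theta 1 2 2 p * theta 1 10 0 p =
      2 * (theta 1 12 2 p * theta 1 60 10 p + p ^ 4 * (theta 1 12 6 p * theta 1 60 30 p) +
        p ^ 12 * (theta 1 12 10 p * theta 1 60 50 p)) := by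
  have h := theta_mul_theta_eq_sum (N := 6) (a := 1) (b := -5) (c := 1) (d := 1) (μ := -1)
    (m := ![0, 1, 2, -3, -2, -1]) (n := ![0, 0, 0, 0, 0, 0]) (by norm_num) (by norm_num)
    (by norm_num) (by decide) one_ne_zero one_ne_zero (A := 2) (A' := 10) (by norm_num)
    (by norm_num) (by norm_num) 2 0 hp0 hp
  simp only [Fin.sum_univ_six, Matrix.cons_val] at h
  norm_num [theta_neg_right, zpow_ofNat] at h
  linear_combination h

lemma theta_two_zero_mul_theta_ten_ten (hp0 : p ≠ 0) (hp : ‖p‖ < 1) :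
    theta 1 2 0 p * theta 1 10 10 p =
      2 * (theta 1 12 10 p * theta 1 60 10 p + p ^ 2 * (theta 1 12 6 p * theta 1 60 30 p) +
        p ^ 8 * (theta 1 12 2 p * theta 1 60 50 p)) := by
  have h := theta_mul_theta_eq_sum (N := 6) (a := 1) (b := -5) (c := 1) (d := 1) (μ := -1)
    (m := ![0, 0, 1, 2, -2, -1]) (n := ![0, -1, -1, -1, 0, 0]) (by norm_num) (by norm_num)
    (by norm_num) (by decide) one_ne_zero one_ne_zero (A := 2) (A' := 10) (by norm_num)
    (by norm_num) (by norm_num) 0 10 hp0 hp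
  simp only [Fin.sum_univ_six, Matrix.cons_val] at h
  norm_num [theta_neg_right, zpow_ofNat] at h
  linear_combination h

lemma theta_one_one_mul_theta_five_zero_sub (hp0 : p ≠ 0) (hp : ‖p‖ < 1) :
    theta 1 1 1 (p ^ 2) * theta 1 5 0 (p ^ 2) -
      p ^ 2 * (theta 1 1 0 (p ^ 2) * theta 1 5 5 (p ^ 2)) =
      2 * (theta (-1) 3 1 p * theta (-1) 3 1 (p ^ 5)) := by
  rw [theta_neg_three_one_eq_sub hp0 hp, theta_neg_three_one_eq_sub (pow_ne_zero 5 hp0)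
    (norm_pow_lt_one hp (by norm_num))]
  have h := theta_two_two_mul_theta_ten_zero hp0 hp
  have h' := theta_two_zero_mul_theta_ten_ten hp0 hp
  simp only [theta_pow]
  norm_num
  linear_combination h - p ^ 2 * h'

lemma theta_neg_three_one_eq_qPoch (hp0 : p ≠ 0) (hp : ‖p‖ < 1) :
    theta (-1) 3 1 p = qPoch (p ^ 2) (p ^ 2) := by
  have h := theta_eq_mul_qPoch (ε := -1) (by norm_num) (A := 3) (by norm_num) 1 hp0 hp
  rw [h, qPoch_eq_prod_qPoch_pow (p ^ 2) (norm_pow_lt_one hp two_ne_zero) 3]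
  norm_num [Fin.prod_univ_three, zpow_ofNat, ← pow_mul, ← pow_add]
  ring

end LevelFive

/-! ### The five-dissection -/

section Dissection

variable {p q : ℂ}

lemma theta_neg_five_one_eq_qPoch (hp0 : p ≠ 0) (hp : ‖p‖ < 1) :
    theta (-1) 5 1 p = qPoch (p ^ 10) (p ^ 10) * qPochs [p ^ 4, p ^ 6] (p ^ 10) := by
  rw [theta_eq_mul_qPoch (by norm_num) (by norm_num) _ hp0 hp]
  norm_num [qPochs, zpow_ofNat, mul_comm]

lemma theta_neg_five_three_eq_qPoch (hp0 : p ≠ 0) (hp : ‖p‖ < 1) :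
    theta (-1) 5 3 p = qPoch (p ^ 10) (p ^ 10) * qPochs [p ^ 2, p ^ 8] (p ^ 10) := by
  rw [theta_eq_mul_qPoch (by norm_num) (by norm_num) _ hp0 hp]
  norm_num [qPochs, zpow_ofNat, mul_comm]

lemma theta_five_one_eq_qPoch (hp0 : p ≠ 0) (hp : ‖p‖ < 1) :
    theta 1 5 1 p = qPoch (p ^ 10) (p ^ 10) * qPochs [-p ^ 4, -p ^ 6] (p ^ 10) := by
  rw [theta_eq_mul_qPoch (by norm_num) (by norm_num) _ hp0 hp]
  norm_num [qPochs, zpow_ofNat, mul_comm]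

lemma qPochs_four_eq_mul (q : ℂ) :
    qPochs [q, q ^ 2, q ^ 3, q ^ 4] (q ^ 5) =
      qPochs [q, q ^ 4] (q ^ 5) * qPochs [q ^ 2, q ^ 3] (q ^ 5) := by
  simp only [qPochs, List.map_cons, List.map_nil, List.prod_cons, List.prod_nil]
  ring

lemma qPoch_self_eq_mul_qPochs (hq : ‖q‖ < 1) :
    qPoch q q = qPoch (q ^ 5) (q ^ 5) * qPochs [q, q ^ 2, q ^ 3, q ^ 4] (q ^ 5) := by
  rw [qPoch_eq_prod_qPoch_pow q hq 5]
  norm_num [Fin.prod_univ_five, qPochs, ← pow_succ']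
  ring

lemma theta_neg_five_three_mul_eq_qPoch (hp0 : p ≠ 0) (hp : ‖p‖ < 1) :
    theta (-1) 5 3 p * theta (-1) 5 1 p =
      qPoch (p ^ 2) (p ^ 2) * qPoch (p ^ 10) (p ^ 10) := by
  rw [theta_neg_five_three_eq_qPoch hp0 hp, theta_neg_five_one_eq_qPoch hp0 hp,
    qPoch_self_eq_mul_qPochs (norm_pow_lt_one hp two_ne_zero)]
  norm_num [qPochs, ← pow_mul]
  ring

lemma theta_one_one_mul_theta_five_zero_sub_eq_theta_neg (hp0 : p ≠ 0) (hp : ‖p‖ < 1) :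
    theta 1 1 1 (p ^ 2) * theta 1 5 0 (p ^ 2) -
      p ^ 2 * (theta 1 1 0 (p ^ 2) * theta 1 5 5 (p ^ 2)) =
      2 * (theta (-1) 5 3 p * theta (-1) 5 1 p) := by
  rw [theta_one_one_mul_theta_five_zero_sub hp0 hp, theta_neg_three_one_eq_qPoch hp0 hp,
    theta_neg_three_one_eq_qPoch (pow_ne_zero 5 hp0) (norm_pow_lt_one hp (by norm_num)),
    theta_neg_five_three_mul_eq_qPoch hp0 hp, ← pow_mul]

lemma exists_sq_eq (hq0 : q ≠ 0) (hq : ‖q‖ < 1) : ∃ p : ℂ, p ≠ 0 ∧ ‖p‖ < 1 ∧ p ^ 2 = q := by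
  obtain ⟨p, rfl⟩ := IsAlgClosed.exists_pow_nat_eq q two_pos
  rw [norm_pow] at hq
  exact ⟨p, ne_zero_pow two_ne_zero hq0,
    (pow_lt_one_iff_of_nonneg (norm_nonneg p) two_ne_zero).mp hq, rfl⟩

lemma theta_five_one_mul_sub_mul_conj (hq0 : q ≠ 0) (hq : ‖q‖ < 1) :
    (theta 1 5 1 q * (theta 1 1 0 q - theta 1 5 0 q) -
        q * theta 1 5 4 q * (theta 1 1 1 q - q * theta 1 5 5 q)) *
      (theta 1 5 1 q * (theta 1 1 0 q + theta 1 5 0 q) +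
        q * theta 1 5 4 q * (theta 1 1 1 q + q * theta 1 5 5 q)) = 0 := by
  obtain ⟨p, hp0, hp, rfl⟩ := exists_sq_eq hq0 hq
  have h0 := theta_one_one_zero_sq hq0 hq
  have h1 := theta_one_one_one_sq hq0 hq
  have hdet := theta_one_one_mul_theta_five_zero_sub_eq_theta_neg hp0 hp
  rw [theta_neg_five_three_mul_theta_neg_five_one hp0 hp] at hdet
  linear_combination theta 1 5 1 (p ^ 2) ^ 2 * h0 - p ^ 4 * theta 1 5 4 (p ^ 2) ^ 2 * h1 -
    2 * p ^ 2 * theta 1 5 1 (p ^ 2) * theta 1 5 4 (p ^ 2) * hdet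

lemma theta_five_one_mul_sub (hq : ‖q‖ < 1) :
    theta 1 5 1 q * (theta 1 1 0 q - theta 1 5 0 q) =
      q * theta 1 5 4 q * (theta 1 1 1 q - q * theta 1 5 5 q) := by
  have hd {A B : ℤ} (hA : 0 < A) (hB : |B| ≤ A) := differentiableOn_theta one_ne_zero hA hB
  have h10 := hd (A := 1) (B := 0) (by norm_num) (by norm_num)
  have h11 := hd (A := 1) (B := 1) (by norm_num) (by norm_num)
  have h50 := hd (A := 5) (B := 0) (by norm_num) (by norm_num)
  have h51 := hd (A := 5) (B := 1) (by norm_num) (by norm_num)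
  have h54 := hd (A := 5) (B := 4) (by norm_num) (by norm_num)
  have h55 := hd (A := 5) (B := 5) (by norm_num) (by norm_num)
  -- The conjugate factor `g` equals `2` at the origin, so analyticity allows it to be cancelled.
  let f (z : ℂ) := theta 1 5 1 z * (theta 1 1 0 z - theta 1 5 0 z) -
    z * theta 1 5 4 z * (theta 1 1 1 z - z * theta 1 5 5 z)
  let g (z : ℂ) := theta 1 5 1 z * (theta 1 1 0 z + theta 1 5 0 z) +
    z * theta 1 5 4 z * (theta 1 1 1 z + z * theta 1 5 5 z)
  have hf : DifferentiableOn ℂ f (Metric.ball 0 1) := by fun_prop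
  have hg : DifferentiableOn ℂ g (Metric.ball 0 1) := by fun_prop
  have hg0 : g 0 ≠ 0 := by norm_num [g, theta_zero_right]
  have hfg (z : ℂ) (hz : z ∈ Metric.ball (0 : ℂ) 1) : f z * g z = 0 := by
    rcases eq_or_ne z 0 with rfl | hz0
    · norm_num [f, theta_zero_right]
    · exact theta_five_one_mul_sub_mul_conj hz0 (mem_ball_zero_iff.mp hz)
  rcases (hf.analyticOnNhd Metric.isOpen_ball).eq_zero_or_eq_zero_of_mul_eq_zero
    (hg.analyticOnNhd Metric.isOpen_ball) hfg (convex_ball _ _).isPreconnected with h | h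
  · exact sub_eq_zero.mp (h q (mem_ball_zero_iff.mpr hq))
  · exact absurd (h 0 (Metric.mem_ball_self one_pos)) hg0

lemma theta_five_three_mul_add (hq0 : q ≠ 0) (hq : ‖q‖ < 1) :
    theta 1 5 3 q * (theta 1 1 0 q + theta 1 5 0 q) =
      theta 1 5 2 q * (theta 1 1 1 q + q * theta 1 5 5 q) := by
  have h0 := theta_one_one_zero_sq hq0 hq
  have h1 := theta_one_one_one_sq hq0 hq
  have hne {B : ℤ} (hB : |B| < 5) : theta 1 5 B q ≠ 0 := theta_ne_zero norm_one hB hq0 hq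
  have hprod : (theta 1 1 1 q - q * theta 1 5 5 q) * (theta 1 1 1 q + q * theta 1 5 5 q) ≠ 0 := by
    rw [show _ * _ = 4 * (theta 1 5 3 q * theta 1 5 1 q) by linear_combination h1]
    exact mul_ne_zero (by norm_num) (mul_ne_zero (hne (by norm_num)) (hne (by norm_num)))
  refine mul_left_cancel₀ (mul_ne_zero (mul_ne_zero hq0 (hne (B := 4) (by norm_num)))
    (left_ne_zero_of_mul hprod)) ?_
  linear_combination theta 1 5 3 q * theta 1 5 1 q * h0 - q * theta 1 5 4 q * theta 1 5 2 q * h1 -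
    theta 1 5 3 q * (theta 1 1 0 q + theta 1 5 0 q) * theta_five_one_mul_sub hq

theorem theta_dissection (hp0 : p ≠ 0) (hp : ‖p‖ < 1) (hpq : p ^ 2 = q) :
    theta 1 5 1 p ^ 2 * theta (-1) 5 3 q =
      theta (-1) 5 1 (q ^ 5) * theta (-1) 5 1 (p ^ 5) ^ 2 +
      q ^ 2 * (theta (-1) 5 1 (q ^ 5) * theta (-1) 5 3 (p ^ 5) ^ 2) +
      2 * q ^ 3 * (theta (-1) 5 3 (q ^ 5) * (theta (-1) 5 3 (p ^ 5) * theta (-1) 5 1 (p ^ 5))) -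
      q ^ 4 * (theta (-1) 5 3 (q ^ 5) * theta (-1) 5 3 (p ^ 5) ^ 2) := by
  have hq0 : q ≠ 0 := hpq ▸ pow_ne_zero 2 hp0
  have hq : ‖q‖ < 1 := hpq ▸ norm_pow_lt_one hp two_ne_zero
  have hP0 : p ^ 5 ≠ 0 := pow_ne_zero 5 hp0
  have hP : ‖p ^ 5‖ < 1 := norm_pow_lt_one hp (by norm_num)
  have hPQ : (p ^ 5) ^ 2 = q ^ 5 := by rw [← hpq]; ring
  have hQ : ‖q ^ 5‖ < 1 := norm_pow_lt_one hq (by norm_num)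
  have hzero : theta 1 5 0 q = theta 1 1 0 (q ^ 5) := by norm_num [theta_pow]
  have hfive : theta 1 5 5 q = theta 1 1 1 (q ^ 5) := by norm_num [theta_pow]
  have hone := theta_five_one_mul_theta_neg_five_three hq0 hq
  have hfour := theta_five_four_mul_theta_neg_five_three hq0 hq
  have hsub := theta_five_one_mul_sub hQ
  have hadd := theta_five_three_mul_add (pow_ne_zero 5 hq0) hQ
  have hsq := theta_five_one_sq (ε := -1) (by norm_num) hP0 hP
  have hsq' := theta_neg_five_three_sq hP0 hP
  have hdet := theta_one_one_mul_theta_five_zero_sub_eq_theta_neg hP0 hP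
  rw [pow_mul (p ^ 5) 2 2] at hsq
  rw [hPQ] at hsq hsq' hdet
  rw [theta_five_one_sq (one_pow 2) hp0 hp, pow_mul p 2 2, hpq, hzero, hfive]
  linear_combination theta 1 1 0 (q ^ 5) * hone + q ^ 2 * theta 1 1 1 (q ^ 5) * hfour +
    theta (-1) 5 1 (q ^ 5) * (hsub - hsq) - q ^ 2 * theta (-1) 5 1 (q ^ 5) * (hadd + hsq') +
    q ^ 3 * theta (-1) 5 3 (q ^ 5) * hdet + q ^ 4 * theta (-1) 5 3 (q ^ 5) * (hadd + hsq')

end Dissection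

/-! ### Product formulas for the components -/

/-- The product formula for the generating function of the coefficients of `F` at exponents
congruent to `r` modulo five; `q` here is the fifth power of the variable of `F`. -/
noncomputable def component (r : Fin 5) (q : ℂ) : ℂ :=
  ![1 / (qPochs [q, q ^ 4] (q ^ 5) ^ 2 * qPochs [q ^ 2, q ^ 8] (q ^ 10)),
    0,
    1 / (qPochs [q ^ 2, q ^ 3] (q ^ 5) ^ 2 * qPochs [q ^ 2, q ^ 8] (q ^ 10)),
    2 / (qPochs [q, q ^ 2, q ^ 3, q ^ 4] (q ^ 5) * qPochs [q ^ 4, q ^ 6] (q ^ 10)),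
    -1 / (qPochs [q ^ 2, q ^ 3] (q ^ 5) ^ 2 * qPochs [q ^ 4, q ^ 6] (q ^ 10))] r

lemma qPochs_ne_zero {as : List ℂ} (ha : ∀ a ∈ as, ‖a‖ < 1) {q : ℂ} (hq : ‖q‖ < 1) :
    qPochs as q ≠ 0 :=
  List.prod_ne_zero (by simpa using fun a h => qPoch_ne_zero (ha a h) hq)

lemma component_mul_qPoch {p : ℂ} (hp0 : p ≠ 0) (hp : ‖p‖ < 1) (r : Fin 5) :
    component r (p ^ 2) * (qPoch (p ^ 2) (p ^ 2) ^ 2 * qPoch (p ^ 4) (p ^ 4)) =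
      ![theta (-1) 5 1 (p ^ 2) * theta (-1) 5 1 p ^ 2, 0,
        theta (-1) 5 1 (p ^ 2) * theta (-1) 5 3 p ^ 2,
        2 * (theta (-1) 5 3 (p ^ 2) * (theta (-1) 5 3 p * theta (-1) 5 1 p)),
        -(theta (-1) 5 3 (p ^ 2) * theta (-1) 5 3 p ^ 2)] r := by
  have hp2 : ‖p ^ 2‖ < 1 := norm_pow_lt_one hp two_ne_zero
  have hp4 : ‖p ^ 4‖ < 1 := norm_pow_lt_one hp four_ne_zero
  have hne {i j k : ℕ} (hi : i ≠ 0) (hj : j ≠ 0) (hk : k ≠ 0) : qPochs [p ^ i, p ^ j] (p ^ k) ≠ 0 :=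
    qPochs_ne_zero (by simp [pow_lt_one₀, hp, hi, hj]) (norm_pow_lt_one hp hk)
  have h2 := hne (i := 2) (j := 8) (k := 10) (by norm_num) (by norm_num) (by norm_num)
  have h4 := hne (i := 4) (j := 6) (k := 10) (by norm_num) (by norm_num) (by norm_num)
  have h4' := hne (i := 4) (j := 16) (k := 20) (by norm_num) (by norm_num) (by norm_num)
  have h8 := hne (i := 8) (j := 12) (k := 20) (by norm_num) (by norm_num) (by norm_num)
  have hfour := qPochs_four_eq_mul (p ^ 2)
  rw [theta_neg_five_one_eq_qPoch hp0 hp, theta_neg_five_three_eq_qPoch hp0 hp,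
    theta_neg_five_one_eq_qPoch (pow_ne_zero 2 hp0) hp2,
    theta_neg_five_three_eq_qPoch (pow_ne_zero 2 hp0) hp2, qPoch_self_eq_mul_qPochs hp2,
    qPoch_self_eq_mul_qPochs hp4, qPochs_four_eq_mul, qPochs_four_eq_mul]
  simp only [← pow_mul, Nat.reduceMul] at hfour ⊢
  fin_cases r <;> simp [component, hfour, ← pow_mul] <;> field_simp

theorem F_eq_sum_component {q : ℂ} (hq : ‖q‖ < 1) :
    F q = ∑ r : Fin 5, q ^ (r : ℕ) * component r (q ^ 5) := by
  rcases eq_or_ne q 0 with rfl | hq0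
  · simp [F, component, qPochs, qPoch, Fin.sum_univ_five]
  obtain ⟨p, hp0, hp, rfl⟩ := exists_sq_eq hq0 hq
  have hP0 : p ^ 5 ≠ 0 := pow_ne_zero 5 hp0
  have hP : ‖p ^ 5‖ < 1 := norm_pow_lt_one hp (by norm_num)
  have hE {k : ℕ} (hk : k ≠ 0) : qPoch (p ^ k) (p ^ k) ≠ 0 :=
    qPoch_ne_zero (norm_pow_lt_one hp hk) (norm_pow_lt_one hp hk)
  have hF : F (p ^ 2) * (qPoch (p ^ 10) (p ^ 10) ^ 2 * qPoch (p ^ 20) (p ^ 20)) =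
      theta 1 5 1 p ^ 2 * theta (-1) 5 3 (p ^ 2) := by
    rw [theta_five_one_eq_qPoch hp0 hp, theta_neg_five_three_eq_qPoch hq0 hq, F]
    simp only [← pow_mul, Nat.reduceMul]
    ring
  have hcomponent := component_mul_qPoch hP0 hP
  simp only [← pow_mul, Nat.reduceMul] at hcomponent
  refine mul_right_cancel₀ (mul_ne_zero (pow_ne_zero 2 (hE (k := 10) (by norm_num)))
    (hE (k := 20) (by norm_num))) ?_
  rw [hF, theta_dissection hp0 hp rfl, sum_mul]
  simp only [mul_assoc, ← pow_mul, Nat.reduceMul, hcomponent, Fin.sum_univ_five, Matrix.cons_val,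
    Fin.coe_ofNat_eq_mod, Nat.reduceMod, pow_zero]
  ring

/-! ### Power series coefficients -/

lemma differentiableOn_qPoch {u v : ℂ → ℂ} {s : Set ℂ} (hs : IsOpen s)
    (hu : DifferentiableOn ℂ u s) (hv : DifferentiableOn ℂ v s) (hv1 : ∀ z ∈ s, ‖v z‖ < 1) :
    DifferentiableOn ℂ (fun z => qPoch (u z) (v z)) s := by
  intro w hw
  obtain ⟨r, hwr, hr⟩ := exists_between (hv1 w hw)
  have hr0 : 0 ≤ r := (norm_nonneg _).trans hwr.le
  let t : Set ℂ := s ∩ (fun z => (‖u z‖, ‖v z‖)) ⁻¹' (Set.Iio (‖u w‖ + 1) ×ˢ Set.Iio r)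
  have ht : IsOpen t := (hu.continuousOn.norm.prodMk hv.continuousOn.norm).isOpen_inter_preimage hs
    (isOpen_Iio.prod isOpen_Iio)
  have hts : t ⊆ s := Set.inter_subset_left
  have hterm (n : ℕ) : DifferentiableOn ℂ (fun z => -(u z * v z ^ n)) t :=
    ((hu.mono hts).mul ((hv.mono hts).pow n)).neg
  have hbound : Summable fun n : ℕ => (‖u w‖ + 1) * r ^ n :=
    (summable_geometric_of_lt_one hr0 hr).mul_left _
  have hprod := hbound.hasProdLocallyUniformlyOn_one_add (f := fun n z => -(u z * v z ^ n)) ht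
    (Eventually.of_forall fun n z ⟨_, huz, hvz⟩ => by
      rw [norm_neg, norm_mul, norm_pow]
      exact mul_le_mul huz.le (pow_le_pow_left₀ (norm_nonneg _) hvz.le n) (by positivity)
        (by positivity))
    (fun n => (hterm n).continuousOn)
  rw [hasProdLocallyUniformlyOn_iff_tendstoLocallyUniformlyOn] at hprod
  have hdiff := hprod.differentiableOn (Eventually.of_forall fun i =>
    DifferentiableOn.fun_finsetProd fun n _ => (hterm n).const_add 1) ht
  simp only [← sub_eq_add_neg] at hdiff
  exact (hdiff.differentiableAt (ht.mem_nhds ⟨hw, by simp, hwr⟩)).differentiableWithinAt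

lemma differentiableOn_qPoch_pow (a : ℕ) {b : ℕ} (hb : b ≠ 0) :
    DifferentiableOn ℂ (fun q => qPoch (q ^ a) (q ^ b)) (Metric.ball 0 1) :=
  differentiableOn_qPoch Metric.isOpen_ball (by fun_prop) (by fun_prop)
    fun _ hq => norm_pow_lt_one (mem_ball_zero_iff.mp hq) hb

lemma differentiableOn_component (r : Fin 5) :
    DifferentiableOn ℂ (component r) (Metric.ball 0 1) := by
  have hdiff (l : List ℕ) {k : ℕ} (hk : k ≠ 0) :
      DifferentiableOn ℂ (fun q => qPochs (l.map (q ^ ·)) (q ^ k)) (Metric.ball 0 1) := by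
    simp only [qPochs, List.map_map]
    induction l with
    | nil => simp
    | cons a l ih => simpa using (differentiableOn_qPoch_pow a hk).fun_mul ih
  have hne {l : List ℕ} (hl : 0 ∉ l) {k : ℕ} (hk : k ≠ 0) {q : ℂ} (hq : q ∈ Metric.ball (0 : ℂ) 1) :
      qPochs (l.map (q ^ ·)) (q ^ k) ≠ 0 := by
    rw [mem_ball_zero_iff] at hq
    refine qPochs_ne_zero (fun a ha => ?_) (norm_pow_lt_one hq hk)
    obtain ⟨i, hi, rfl⟩ := List.mem_map.mp ha
    exact norm_pow_lt_one hq (ne_of_mem_of_not_mem hi hl)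
  have hquot (c : ℂ) {l l' : List ℕ} (hl : 0 ∉ l) (hl' : 0 ∉ l') (e : ℕ) : DifferentiableOn ℂ
      (fun q => c / (qPochs (l.map (q ^ ·)) (q ^ 5) ^ e * qPochs (l'.map (q ^ ·)) (q ^ 10)))
      (Metric.ball 0 1) :=
    (differentiableOn_const c).fun_div
      (((hdiff l (by norm_num)).fun_pow e).fun_mul (hdiff l' (by norm_num)))
      fun q hq => mul_ne_zero (pow_ne_zero e (hne hl (by norm_num) hq)) (hne hl' (by norm_num) hq)
  fin_cases r
  · exact (hquot 1 (l := [1, 4]) (l' := [2, 8]) (by simp) (by simp) 2).congr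
      fun q _ => by simp [component]
  · exact differentiableOn_const 0
  · exact (hquot 1 (l := [2, 3]) (l' := [2, 8]) (by simp) (by simp) 2).congr
      fun q _ => by simp [component]
  · exact (hquot 2 (l := [1, 2, 3, 4]) (l' := [4, 6]) (by simp) (by simp) 1).congr
      fun q _ => by simp [component]
  · exact (hquot (-1) (l := [2, 3]) (l' := [4, 6]) (by simp) (by simp) 2).congr
      fun q _ => by simp [component]

lemma hasSum_taylor {f : ℂ → ℂ} (hf : DifferentiableOn ℂ f (Metric.ball 0 1)) {q : ℂ}
    (hq : ‖q‖ < 1) :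
    HasSum (fun n : ℕ => iteratedDeriv n f 0 / (n.factorial : ℂ) * q ^ n) (f q) := by
  simpa [div_eq_mul_inv, mul_comm, mul_left_comm] using
    Complex.hasSum_taylorSeries_on_ball hf (mem_ball_zero_iff.mpr hq)

lemma iteratedDeriv_div_factorial_of_hasSum {c : ℕ → ℂ} {f : ℂ → ℂ}
    (hc : ∀ q : ℂ, ‖q‖ < 1 → HasSum (fun n => c n * q ^ n) (f q)) (n : ℕ) :
    iteratedDeriv n f 0 / (n.factorial : ℂ) = c n := by
  have hf : HasFPowerSeriesAt f (FormalMultilinearSeries.ofScalars ℂ c) 0 := by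
    rw [hasFPowerSeriesAt_iff]
    filter_upwards [Metric.ball_mem_nhds (0 : ℂ) one_pos] with q hq
    simpa [FormalMultilinearSeries.coeff_ofScalars, mul_comm] using hc q (mem_ball_zero_iff.mp hq)
  have h := hf.eq_formalMultilinearSeries hf.analyticAt.hasFPowerSeriesAt
  simpa [FormalMultilinearSeries.coeff_ofScalars] using
    (congrArg (fun p : FormalMultilinearSeries ℂ ℂ ℂ => p.coeff n) h).symm

lemma hasSum_of_residues {M : Type*} [AddCommMonoid M] [TopologicalSpace M] [ContinuousAdd M]
    {k : ℕ} [NeZero k] {f : ℕ → M} {a : Fin k → M}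
    (h : ∀ r : Fin k, HasSum (fun n => f (k * n + r)) (a r)) : HasSum f (∑ r, a r) := by
  let t (r : Fin k) : Set ℕ := Set.range fun n => k * n + (r : ℕ)
  have hmod (r : Fin k) {m : ℕ} (hm : m ∈ t r) : Fin.ofNat k m = r := by
    obtain ⟨n, rfl⟩ := hm
    exact Fin.ext (by simp [Nat.mod_eq_of_lt r.is_lt])
  have hunion : ⋃ r ∈ (univ : Finset (Fin k)), t r = Set.univ :=
    Set.eq_univ_of_forall fun m => Set.mem_biUnion (mem_univ (Fin.ofNat k m))
      ⟨m / k, by simpa using Nat.div_add_mod m k⟩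
  have hsum := hasSum_sum_disjoint (f := f) (t := t) (a := a) univ
    (fun r _ s _ hrs => Set.disjoint_left.mpr fun m hr hs =>
      hrs ((hmod r hr).symm.trans (hmod s hs)))
    fun r _ => (Function.Injective.hasSum_range_iff fun m n hmn =>
      Nat.eq_of_mul_eq_mul_left (NeZero.pos k) (Nat.add_right_cancel hmn)).mpr (h r)
  rwa [hasSum_subtype_iff_indicator, hunion, Set.indicator_univ] at hsum

lemma hasSum_taylor_of_eq_sum {k : ℕ} [NeZero k] {f : ℂ → ℂ} {g : Fin k → ℂ → ℂ}
    (hg : ∀ r, DifferentiableOn ℂ (g r) (Metric.ball 0 1)) {q : ℂ} (hq : ‖q‖ < 1)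
    (hf : f q = ∑ r : Fin k, q ^ (r : ℕ) * g r (q ^ k)) :
    HasSum (fun m : ℕ => iteratedDeriv (m / k) (g (Fin.ofNat k m)) 0 /
      ((m / k).factorial : ℂ) * q ^ m) (f q) := by
  rw [hf]
  refine hasSum_of_residues fun r => ?_
  have hdiv (n : ℕ) : (k * n + r) / k = n := by
    rw [Nat.mul_add_div (NeZero.pos k), Nat.div_eq_of_lt r.is_lt, add_zero]
  have hmod (n : ℕ) : Fin.ofNat k (k * n + r) = r :=
    Fin.ext (by simp [Nat.mod_eq_of_lt r.is_lt])
  simpa only [hdiv, hmod, pow_add, pow_mul, mul_assoc, mul_comm, mul_left_comm] using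
    (hasSum_taylor (hg r) (norm_pow_lt_one hq (NeZero.ne k))).mul_left (q ^ (r : ℕ))

lemma h₁_eq_component_coeff (m : ℕ) :
    h₁ m = iteratedDeriv (m / 5) (component (Fin.ofNat 5 m)) 0 / ((m / 5).factorial : ℂ) :=
  iteratedDeriv_div_factorial_of_hasSum (fun _ hq =>
    hasSum_taylor_of_eq_sum differentiableOn_component hq (F_eq_sum_component hq)) m

lemma hasSum_F {q : ℂ} (hq : ‖q‖ < 1) : HasSum (fun n : ℕ => h₁ n * q ^ n) (F q) := by
  simpa only [h₁_eq_component_coeff] using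
    hasSum_taylor_of_eq_sum differentiableOn_component hq (F_eq_sum_component hq)

lemma h₁_five_mul_add (r : Fin 5) (n : ℕ) :
    h₁ (5 * n + r) = iteratedDeriv n (component r) 0 / (n.factorial : ℂ) := by
  have hdiv : (5 * n + (r : ℕ)) / 5 = n := by lia
  have hmod : Fin.ofNat 5 (5 * n + r) = r := Fin.ext (by simp)
  rw [h₁_eq_component_coeff, hdiv, hmod]

lemma hasSum_component (r : Fin 5) {q : ℂ} (hq : ‖q‖ < 1) :
    HasSum (fun n : ℕ => h₁ (5 * n + r) * q ^ n) (component r q) := by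
  simpa only [h₁_five_mul_add] using hasSum_taylor (differentiableOn_component r) hq

lemma H_eq_component (r : Fin 5) {q : ℂ} (hq : ‖q‖ < 1) : H r q = component r q :=
  (hasSum_component r hq).tsum_eq

end QDissection

theorem mainTheorem2 :
    -- `h₁` is the coefficient sequence: `F(q) = ∑ h₁(n) q ^ n` on the open unit disc
    (∀ q : ℂ, ‖q‖ < 1 → HasSum (fun n : ℕ => QDissection.h₁ n * q ^ n) (QDissection.F q)) ∧
    -- each series `H_r` converges on the open unit disc
    (∀ r : ℕ, r < 5 → ∀ q : ℂ, ‖q‖ < 1 →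
      HasSum (fun n : ℕ => QDissection.h₁ (5 * n + r) * q ^ n) (QDissection.H r q)) ∧
    -- the 5-dissection
    (∀ q : ℂ, ‖q‖ < 1 →
      QDissection.qPochs [-q ^ 2, -q ^ 3] (q ^ 5) ^ 2 * QDissection.qPochs [q ^ 2, q ^ 8] (q ^ 10) =
        QDissection.H 0 (q ^ 5) + q ^ 2 * QDissection.H 2 (q ^ 5) +
          q ^ 3 * QDissection.H 3 (q ^ 5) + q ^ 4 * QDissection.H 4 (q ^ 5)) ∧
    -- the component of residue 1 vanishes
    (∀ n : ℕ, QDissection.h₁ (5 * n + 1) = 0) ∧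
    -- the product formulas for the components
    (∀ q : ℂ, ‖q‖ < 1 →
      QDissection.H 0 q =
        1 / (QDissection.qPochs [q, q ^ 4] (q ^ 5) ^ 2 *
          QDissection.qPochs [q ^ 2, q ^ 8] (q ^ 10)) ∧
      QDissection.H 2 q =
        1 / (QDissection.qPochs [q ^ 2, q ^ 3] (q ^ 5) ^ 2 *
          QDissection.qPochs [q ^ 2, q ^ 8] (q ^ 10)) ∧
      QDissection.H 3 q =
        2 / (QDissection.qPochs [q, q ^ 2, q ^ 3, q ^ 4] (q ^ 5) *
          QDissection.qPochs [q ^ 4, q ^ 6] (q ^ 10)) ∧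
      QDissection.H 4 q =
        -1 / (QDissection.qPochs [q ^ 2, q ^ 3] (q ^ 5) ^ 2 *
          QDissection.qPochs [q ^ 4, q ^ 6] (q ^ 10))) := by
  refine ⟨fun q hq => QDissection.hasSum_F hq,
    fun r hr q hq => (QDissection.hasSum_component ⟨r, hr⟩ hq).summable.hasSum,
    fun q hq => ?_, fun n => ?_,
    fun q hq => ⟨QDissection.H_eq_component 0 hq, QDissection.H_eq_component 2 hq,
      QDissection.H_eq_component 3 hq, QDissection.H_eq_component 4 hq⟩⟩
  · have hH (r : Fin 5) : QDissection.component r (q ^ 5) = QDissection.H r (q ^ 5) :=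
      (QDissection.H_eq_component r (QDissection.norm_pow_lt_one hq (by norm_num))).symm
    have h1 : QDissection.component 1 (q ^ 5) = 0 := rfl
    have hF := QDissection.F_eq_sum_component hq
    rw [Fin.sum_univ_five, h1, hH, hH, hH, hH] at hF
    simpa [QDissection.F] using hF
  · have h1 : QDissection.component 1 = fun _ => 0 := rfl
    simpa [h1] using QDissection.h₁_five_mul_add 1 n
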